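/- Let $\mathbb D$ be the unit disc in $\mathbb C$. For a domain $\Omega\subset\mathbb C^n$ and a set $S=\{a_1,\dots,a_N\}\subset\Omega$ of $N$ distinct points, let $G_S$ be the pluricomplex Green function $$G_S(z)=\sup\{u(z): u \text{ plurisubharmonic on } \Omega,\ u\le 0,\ \text{for each } j \text{ there is } C_j\in\mathbb R \text{ with } u(w)\le\log|w-a_j|+C_j \text{ for all } w\in\Omega\},$$ and let $\ell_S$ be Coman's Lempert function $$\ell_S(z)=\inf\Big\{\sum_{j=1}^N\log|\zeta_j| : \varphi:\mathbb D\to\Omega \text{ holomorphic},\ \varphi(0)=z,\ \zeta_j\in\mathbb D,\ \varphi(\zeta_j)=a_j,\ j=1,\dots,N\Big\},$$ with the convention $\log 0=-\infty$. Let $\Omega=\mathbb D^2$, let $\rho$ be a complex-valued function of the complex variable $\varepsilon$ with $\lim_{\varepsilon\to0,\,\varepsilon\ne0}\rho(\varepsilon)/\varepsilon=0$, and let $S_\varepsilon=\{(0,0),(\rho(\varepsilon),0),(0,\varepsilon)\}$. Then there exist $C_1>0$ and, for every $\delta\in(0,\frac14)$, a radius $r_0=r_0(\delta)>0$ such that,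 for every $z=(z_1,z_2)\in\mathbb D^2$ with $$\tfrac12|z_2|^{3/2}\le|z_1|\le|z_2|^{3/2},\qquad \|z\|<r_0,$$ there exists $\varepsilon_0=\varepsilon_0(z,\delta)>0$ such that, for every $\varepsilon\in\mathbb C$ with $0<|\varepsilon|<\varepsilon_0$ and $\rho(\varepsilon)\ne0$ (so that $S_\varepsilon$ consists of three distinct points), $$G_{S_\varepsilon}(z)\le 2\log|z_2|+C_1\qquad\text{and}\qquad \ell_{S_\varepsilon}(z)\ge(2-\delta)\log|z_2|.$$ -/

import Mathlib

open Set Filter Topology MeasureTheory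

/-- The mean of an extended-real function `u` over the circle `θ ↦ a + e^{iθ} b`, as the mean of
its positive part minus the mean of its negative part. For an upper semicontinuous `u < +∞`
the first one is finite, so this is the usual integral mean with values in `[-∞, ∞)`. -/
noncomputable def circleMean {E : Type*} [NormedAddCommGroup E] [NormedSpace ℂ E]
    (u : E → EReal) (a b : E) : EReal :=
  (((ENNReal.ofReal (2 * Real.pi))⁻¹ * ∫⁻ θ : ℝ in Ioc 0 (2 * Real.pi),
      (u (a + Complex.exp ((θ : ℂ) * Complex.I) • b)).toENNReal : ENNReal) : EReal)
  - (((ENNReal.ofReal (2 * Real.pi))⁻¹ * ∫⁻ θ : ℝ in Ioc 0 (2 * Real.pi),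
      (-u (a + Complex.exp ((θ : ℂ) * Complex.I) • b)).toENNReal : ENNReal) : EReal)

/-- Plurisubharmonic functions on `Ω`, with values in `[-∞, ∞)`: upper semicontinuous, with the
sub-mean value inequality on the boundary of every closed disc of a complex line that lies in `Ω`.
(The function that is identically `-∞` is admitted.) -/
structure IsPlurisubharmonicOn {E : Type*} [NormedAddCommGroup E] [NormedSpace ℂ E]
    (u : E → EReal) (Ω : Set E) : Prop where
  lt_top : ∀ z ∈ Ω, u z < ⊤
  upperSemicontinuousOn : UpperSemicontinuousOn u Ω
  le_circleMean : ∀ a b : E, (∀ ζ : ℂ, ‖ζ‖ ≤ 1 → a + ζ • b ∈ Ω) → u a ≤ circleMean u a b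

/-- The pluricomplex Green function of `Ω` with logarithmic singularities at the poles `a j`:
the supremum at `z` of the plurisubharmonic `u ≤ 0` on `Ω` such that, for every `j`,
`u w ≤ log |w - a j| + C_j` on `Ω`. Here `ENNReal.log` is the logarithm with `log 0 = -∞`. -/
noncomputable def pluricomplexGreen {E : Type*} [NormedAddCommGroup E] [NormedSpace ℂ E]
    {ι : Type*} (Ω : Set E) (a : ι → E) (z : E) : EReal :=
  sSup {t : EReal | ∃ u : E → EReal,
    IsPlurisubharmonicOn u Ω ∧ (∀ w ∈ Ω, u w ≤ 0) ∧
    (∀ j, ∃ C : ℝ, ∀ w ∈ Ω, u w ≤ ENNReal.log ‖w - a j‖ₑ + (C : EReal)) ∧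
    t = u z}

/-- Coman's Lempert function of `Ω` for the (distinct) poles `a j`: the infimum of
`∑ j, log |ζ j|` over all holomorphic maps `φ` of the unit disc to `Ω` with `φ 0 = z` and all
points `ζ j` of the unit disc with `φ (ζ j) = a j`. -/
noncomputable def lempertFunction {E : Type*} [NormedAddCommGroup E] [NormedSpace ℂ E]
    {ι : Type*} [Fintype ι] (Ω : Set E) (a : ι → E) (z : E) : EReal :=
  sInf {t : EReal | ∃ (φ : ℂ → E) (ζ : ι → ℂ),
    DifferentiableOn ℂ φ (Metric.ball 0 1) ∧ MapsTo φ (Metric.ball 0 1) Ω ∧ φ 0 = z ∧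
    (∀ j, ζ j ∈ Metric.ball (0 : ℂ) 1 ∧ φ (ζ j) = a j) ∧
    t = ∑ j, ENNReal.log ‖ζ j‖ₑ}

/-- The unit bidisk in `ℂ²`. -/
def bidisk : Set (ℂ × ℂ) := Metric.ball 0 1 ×ˢ Metric.ball 0 1

/-- The poles `(0, 0)`, `(ρ(ε), 0)`, `(0, ε)`. -/
def threePoles (ρ : ℂ → ℂ) (ε : ℂ) : Fin 3 → ℂ × ℂ :=
  ![(0, 0), (ρ ε, 0), (0, ε)]

/-! The two bounds differ because a rational cubic through the poles can count (0, ε) twice, whereas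
the Lempert function counts each pole once.

Green function. Through z and the three poles passes a curve τ ↦ (kτ(τ(τ-η)-ε), τ(τ-η)), a
perturbation of the cusp (kτ³, τ²); this is where |z₁| ≈ |z₂|^{3/2} enters. The parameters 0 and η
give (0, 0) and (ρ, 0), and both roots of τ(τ-η) = ε give (0, ε). A competitor u restricted to the
curve is thus at most log|P| + O(1) with P = τ(τ-η)(τ(τ-η)-ε), and |P| = |z₂||z₂-ε| ≈ |z₂|² at z
(`IsPlurisubharmonicOn.cubic_le`). Plurisubharmonicity is only given on affine discs, so the maximum
principle along a curve is proved by doubling variables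
(`IsPlurisubharmonicOn.comp_le_of_le_boundary`).

Lempert function. Let a disc (f, g) centred at z reach (0, 0), (ρ, 0), (0, ε) at a, b, c. If |abc|
were below |z₂|^{2-δ}, then a would be far from c, and g(c) = ε would force b close to c. As ρ/ε is
tiny, f divided by its Blaschke factors at a and c would nearly vanish at b too, so that |f(0)|
would be bounded by about 2|abc|, too small for |z₂|^{3/2}/2 (`pow_four_le_mul_of_three_poles`). -/

/-! ### Blaschke factors and the Schwarz lemma -/

/-- The Blaschke factor of the unit disc that vanishes at `a`. -/
noncomputable def blaschkeFactor (a z : ℂ) : ℂ := (z - a) / (1 - (starRingEnd ℂ) a * z)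

theorem one_sub_conj_mul_ne_zero {a z : ℂ} (ha : ‖a‖ < 1) (hz : ‖z‖ < 1) :
    1 - (starRingEnd ℂ) a * z ≠ 0 := by
  intro h
  have h1 : (1 : ℝ) = ‖a‖ * ‖z‖ := by
    have : (starRingEnd ℂ) a * z = 1 := (sub_eq_zero.mp h).symm
    rw [← RCLike.norm_conj (K := ℂ) a, ← norm_mul, this, norm_one]
  nlinarith [norm_nonneg a, norm_nonneg z]

theorem norm_blaschkeFactor_lt_one {a z : ℂ} (ha : ‖a‖ < 1) (hz : ‖z‖ < 1) :
    ‖blaschkeFactor a z‖ < 1 := by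
  have h0 := norm_pos_iff.mpr (one_sub_conj_mul_ne_zero ha hz)
  rw [blaschkeFactor, norm_div, div_lt_one h0]
  refine lt_of_pow_lt_pow_left₀ 2 h0.le ?_
  have key : ‖1 - (starRingEnd ℂ) a * z‖ ^ 2 - ‖z - a‖ ^ 2
      = (1 - ‖a‖ ^ 2) * (1 - ‖z‖ ^ 2) := by
    simp only [← Complex.normSq_eq_norm_sq, Complex.normSq_apply, Complex.sub_re, Complex.sub_im,
      Complex.mul_re, Complex.mul_im, Complex.conj_re, Complex.conj_im, Complex.one_re,
      Complex.one_im]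
    ring
  have : 0 < (1 - ‖a‖ ^ 2) * (1 - ‖z‖ ^ 2) := by
    apply mul_pos <;> nlinarith [norm_nonneg a, norm_nonneg z]
  linarith

theorem blaschkeFactor_neg_blaschkeFactor {a z : ℂ} (ha : ‖a‖ < 1) (hz : ‖z‖ < 1) :
    blaschkeFactor (-a) (blaschkeFactor a z) = z := by
  have h1 := one_sub_conj_mul_ne_zero ha hz
  have h2 := one_sub_conj_mul_ne_zero (a := -a) (by simpa) (norm_blaschkeFactor_lt_one ha hz)
  rw [blaschkeFactor, div_eq_iff h2]
  have h3 : blaschkeFactor a z * (1 - (starRingEnd ℂ) a * z) = z - a := by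
    rw [blaschkeFactor, div_mul_cancel₀ _ h1]
  simp only [map_neg]
  linear_combination h3

theorem differentiableOn_blaschkeFactor {a : ℂ} (ha : ‖a‖ < 1) :
    DifferentiableOn ℂ (blaschkeFactor a) (Metric.ball 0 1) := by
  unfold blaschkeFactor
  refine DifferentiableOn.div (by fun_prop) (by fun_prop) fun z hz => ?_
  exact one_sub_conj_mul_ne_zero ha (by simpa using hz)

theorem norm_blaschkeFactor_zero (a : ℂ) : ‖blaschkeFactor a 0‖ = ‖a‖ := by
  simp [blaschkeFactor]

theorem norm_blaschkeFactor_comm (a z : ℂ) :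
    ‖blaschkeFactor a z‖ = ‖blaschkeFactor z a‖ := by
  have h : (starRingEnd ℂ) (1 - (starRingEnd ℂ) a * z) = 1 - (starRingEnd ℂ) z * a := by
    simp [mul_comm]
  rw [blaschkeFactor, blaschkeFactor, norm_div, norm_div, norm_sub_rev z a, ← h, RCLike.norm_conj]

theorem norm_sub_le_two_mul_norm_blaschkeFactor {a z : ℂ} (ha : ‖a‖ < 1) (hz : ‖z‖ < 1) :
    ‖z - a‖ ≤ 2 * ‖blaschkeFactor a z‖ := by
  have h0 := norm_pos_iff.mpr (one_sub_conj_mul_ne_zero ha hz)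
  have h1 : ‖blaschkeFactor a z‖ * ‖1 - (starRingEnd ℂ) a * z‖ = ‖z - a‖ := by
    rw [blaschkeFactor, norm_div, div_mul_cancel₀ _ h0.ne']
  have h2 : ‖1 - (starRingEnd ℂ) a * z‖ ≤ 2 := by
    refine (norm_sub_le _ _).trans ?_
    rw [norm_one, norm_mul, RCLike.norm_conj]
    nlinarith [norm_nonneg a, norm_nonneg z]
  rw [← h1, mul_comm]
  gcongr

/-- A holomorphic function of the disc bounded by one is divisible by the Blaschke factor at each
of its zeros, with a quotient bounded by one. -/
theorem exists_eq_blaschkeFactor_mul {h : ℂ → ℂ}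
    (hd : DifferentiableOn ℂ h (Metric.ball 0 1)) (hb : ∀ z ∈ Metric.ball (0 : ℂ) 1, ‖h z‖ ≤ 1)
    {a : ℂ} (ha : ‖a‖ < 1) (h0 : h a = 0) :
    ∃ k : ℂ → ℂ, DifferentiableOn ℂ k (Metric.ball 0 1) ∧
      (∀ z ∈ Metric.ball (0 : ℂ) 1, ‖k z‖ ≤ 1) ∧
      ∀ z ∈ Metric.ball (0 : ℂ) 1, h z = blaschkeFactor a z * k z := by
  have ha' : ‖-a‖ < 1 := by simpa
  have hm1 : MapsTo (blaschkeFactor a) (Metric.ball 0 1) (Metric.ball 0 1) := fun z hz => by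
    simpa using norm_blaschkeFactor_lt_one ha (by simpa using hz)
  have hm2 : MapsTo (blaschkeFactor (-a)) (Metric.ball 0 1) (Metric.ball 0 1) := fun z hz => by
    simpa using norm_blaschkeFactor_lt_one ha' (by simpa using hz)
  -- Once the zero is moved to 0, the quotient is a difference quotient at 0, which the Schwarz
  -- lemma bounds by 1.
  set H : ℂ → ℂ := h ∘ blaschkeFactor (-a) with hH
  have hHd : DifferentiableOn ℂ H (Metric.ball 0 1) :=
    hd.comp (differentiableOn_blaschkeFactor ha') hm2
  have hH0 : H 0 = 0 := by simp [hH, blaschkeFactor, h0]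
  have hHb : MapsTo H (Metric.ball 0 1) (Metric.closedBall (H 0) 1) := fun z hz => by
    rw [hH0, mem_closedBall_zero_iff]
    exact hb _ (hm2 hz)
  refine ⟨dslope H 0 ∘ blaschkeFactor a, ?_, fun z hz => ?_, fun z hz => ?_⟩
  · refine DifferentiableOn.comp ?_ (differentiableOn_blaschkeFactor ha) hm1
    exact (Complex.differentiableOn_dslope (Metric.ball_mem_nhds 0 one_pos)).mpr hHd
  · simpa using Complex.norm_dslope_le_div_of_mapsTo_ball hHd hHb (hm1 hz)
  · have h1 := sub_smul_dslope H 0 (blaschkeFactor a z)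
    rw [hH0, sub_zero, sub_zero, smul_eq_mul] at h1
    rw [Function.comp_apply, h1, hH, Function.comp_apply,
      blaschkeFactor_neg_blaschkeFactor ha (by simpa using hz)]

theorem norm_sub_le_two_mul_norm_of_norm_le_one {h : ℂ → ℂ}
    (hd : DifferentiableOn ℂ h (Metric.ball 0 1)) (hb : ∀ z ∈ Metric.ball (0 : ℂ) 1, ‖h z‖ ≤ 1)
    {z : ℂ} (hz : ‖z‖ < 1) : ‖h z - h 0‖ ≤ 2 * ‖z‖ := by
  have hm : MapsTo h (Metric.ball 0 1) (Metric.closedBall (h 0) 2) := fun w hw => by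
    rw [Metric.mem_closedBall, dist_eq_norm]
    have h1 := hb w hw
    have h2 := hb 0 (by simp)
    linarith [norm_sub_le (h w) (h 0)]
  have := Complex.dist_le_div_mul_dist_of_mapsTo_ball hd hm (z := z) (by simpa using hz)
  simpa [dist_eq_norm] using this

/-! ### Discs through three poles -/

set_option maxHeartbeats 1000000 in
/-- Quantitative Schwarz lemma for a disc in the bidisk through `(0, 0)`, `(ρ, 0)` and `(0, ε)`,
where `|ρ|` is much smaller than `|ε|`. -/
theorem pow_four_le_mul_of_three_poles {f g : ℂ → ℂ}
    (hf : DifferentiableOn ℂ f (Metric.ball 0 1)) (hfb : ∀ z ∈ Metric.ball (0 : ℂ) 1, ‖f z‖ ≤ 1)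
    (hg : DifferentiableOn ℂ g (Metric.ball 0 1)) (hgb : ∀ z ∈ Metric.ball (0 : ℂ) 1, ‖g z‖ ≤ 1)
    {a b c ρ ε : ℂ} (ha : ‖a‖ < 1) (hb : ‖b‖ < 1) (hc : ‖c‖ < 1)
    (hfa : f a = 0) (hfb' : f b = ρ) (hfc : f c = 0)
    (hga : g a = 0) (hgb' : g b = 0) (hgc : g c = ε)
    {s X : ℝ} (hs : 0 < s) (hX : 0 < X) (hX1 : X ≤ 1) (hsX : 48 * s ≤ X ^ 2)
    (hg0 : ‖g 0‖ = s ^ 2) (hf0 : s ^ 3 / 2 ≤ ‖f 0‖) (hε : ε ≠ 0) (hρ0 : ρ ≠ 0)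
    (hεs : 1024 * ‖ε‖ ≤ s ^ 2 * X ^ 3) (hρ : 64 * ‖ρ‖ ≤ s ^ 4 * X * ‖ε‖) :
    s ^ 4 ≤ ‖a‖ * ‖b‖ * ‖c‖ * X := by
  have mb : ∀ {w : ℂ}, ‖w‖ < 1 → w ∈ Metric.ball (0 : ℂ) 1 := fun h => by simpa using h
  have hε' : 0 < ‖ε‖ := norm_pos_iff.mpr hε
  by_contra! hcon
  have bne : ∀ {p q : ℂ}, p ≠ q → ‖p‖ < 1 → ‖q‖ < 1 → blaschkeFactor p q ≠ 0 :=
    fun h hp hq => div_ne_zero (sub_ne_zero.mpr h.symm) (one_sub_conj_mul_ne_zero hp hq)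
  have hab : a ≠ b := by rintro rfl; exact hρ0 (hfb'.symm.trans hfa)
  have hac : a ≠ c := by rintro rfl; exact hε (hgc.symm.trans hga)
  obtain ⟨k₁, hk₁d, hk₁b, hk₁⟩ := exists_eq_blaschkeFactor_mul hg hgb ha hga
  obtain ⟨k, hkd, hkb, hk⟩ := exists_eq_blaschkeFactor_mul hk₁d hk₁b hb
    ((mul_eq_zero.mp ((hk₁ b (mb hb)).symm.trans hgb')).resolve_left (bne hab ha hb))
  obtain ⟨l₁, hl₁d, hl₁b, hl₁⟩ := exists_eq_blaschkeFactor_mul hf hfb ha hfa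
  obtain ⟨l, hld, hlb, hl⟩ := exists_eq_blaschkeFactor_mul hl₁d hl₁b hc
    ((mul_eq_zero.mp ((hl₁ c (mb hc)).symm.trans hfc)).resolve_left (bne hac ha hc))
  have hgn : ∀ {z : ℂ}, ‖z‖ < 1 →
      ‖g z‖ = ‖blaschkeFactor a z‖ * ‖blaschkeFactor b z‖ * ‖k z‖ := fun {z} hz => by
    rw [hk₁ z (mb hz), hk z (mb hz), norm_mul, norm_mul, mul_assoc]
  have hfn : ∀ {z : ℂ}, ‖z‖ < 1 →
      ‖f z‖ = ‖blaschkeFactor a z‖ * ‖blaschkeFactor c z‖ * ‖l z‖ := fun {z} hz => by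
    rw [hl₁ z (mb hz), hl z (mb hz), norm_mul, norm_mul, mul_assoc]
  have h01 : ‖(0 : ℂ)‖ < 1 := by simp
  have g0 := hgn h01
  have f0 := hfn h01
  have gc := hgn hc
  have fb := hfn hb
  simp only [norm_blaschkeFactor_zero] at g0 f0
  rw [hg0] at g0
  rw [hgc] at gc
  rw [hfb', norm_blaschkeFactor_comm c b] at fb
  have k0 := hkb 0 (mb h01)
  have l0 := hlb 0 (mb h01)
  have kc1 := hkb c (mb hc)
  have gdist := norm_sub_le_two_mul_norm_of_norm_le_one hg hgb hc
  have kdist := norm_sub_le_two_mul_norm_of_norm_le_one hkd hkb hc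
  have ldist := norm_sub_le_two_mul_norm_of_norm_le_one hld hlb hb
  have gd : s ^ 2 ≤ ‖ε‖ + 2 * ‖c‖ := by
    have := norm_sub_norm_le (g 0) (g c)
    rw [norm_sub_rev, hg0, hgc] at this
    rw [hgc] at gdist
    linarith
  have kd : ‖k 0‖ ≤ ‖k c‖ + 2 * ‖c‖ := by
    have := norm_sub_norm_le (k 0) (k c)
    rw [norm_sub_rev] at this
    linarith
  have ld : ‖l 0‖ ≤ ‖l b‖ + 2 * ‖b‖ := by
    have := norm_sub_norm_le (l 0) (l b)
    rw [norm_sub_rev] at this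
    linarith
  have bac := norm_sub_le_two_mul_norm_blaschkeFactor ha hc
  have bab := norm_sub_le_two_mul_norm_blaschkeFactor ha hb
  have bbc := norm_sub_le_two_mul_norm_blaschkeFactor hb hc
  have bac1 := (norm_blaschkeFactor_lt_one ha hc).le
  have dca : ‖a‖ - ‖c‖ ≤ ‖c - a‖ := by
    rw [norm_sub_rev]; exact norm_sub_norm_le a c
  have dba : ‖c - a‖ ≤ ‖b - a‖ + ‖c - b‖ := by
    have := norm_add_le (b - a) (c - b)
    rwa [show b - a + (c - b) = c - a by ring] at this
  have nA := norm_nonneg a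
  have nB := norm_nonneg b
  have nC := norm_nonneg c
  have nl0 := norm_nonneg (l 0)
  have nlb := norm_nonneg (l b)
  have nk0 := norm_nonneg (k 0)
  have nkc := norm_nonneg (k c)
  have nb1 := norm_nonneg (blaschkeFactor a c)
  have nb2 := norm_nonneg (blaschkeFactor a b)
  have nb3 := norm_nonneg (blaschkeFactor b c)
  -- Only real inequalities remain: p, q, r are the pseudo-hyperbolic distances of the pairs (a, c),
  -- (a, b), (b, c).
  generalize ‖blaschkeFactor a c‖ = p at *
  generalize ‖blaschkeFactor a b‖ = q at *
  generalize ‖blaschkeFactor b c‖ = r at *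
  generalize ‖k 0‖ = K0 at *
  generalize ‖k c‖ = Kc at *
  generalize ‖l 0‖ = L0 at *
  generalize ‖l b‖ = Lb at *
  generalize ‖c - a‖ = dac at *
  generalize ‖b - a‖ = dab at *
  generalize ‖c - b‖ = dbc at *
  generalize ‖ρ‖ = R at *
  generalize ‖ε‖ = e at *
  generalize ‖f 0‖ = F at *
  generalize ‖a‖ = A at *
  generalize ‖b‖ = B at *
  generalize ‖c‖ = C at *
  clear * - hs hX hX1 hsX hf0 hεs hρ hε' hcon g0 f0 gc fb k0 l0 kc1 gd kd ld bac bab bbc bac1 dca dba nA nB nC nl0 nlb nk0 nkc nb1 nb2 nb3 ha hb hc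
  have hX2 : X ^ 2 ≤ X := by nlinarith
  have hs1 : 48 * s ≤ X := hsX.trans hX2
  have hAB : s ^ 2 ≤ A * B := by
    rw [g0]; exact mul_le_of_le_one_right (by positivity) k0
  have hAC : s ^ 3 / 2 ≤ A * C := by
    refine hf0.trans ?_
    rw [f0]; exact mul_le_of_le_one_right (by positivity) l0
  have hX3 : X ^ 3 ≤ 1 := pow_le_one₀ hX.le hX1
  have hC : s ^ 2 / 4 ≤ C := by
    have := mul_le_of_le_one_right (sq_nonneg s) hX3
    linarith
  -- Against `hcon`, each lower bound on a partial product bounds the remaining factor from above.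
  have hB : B * X ≤ 2 * s := by
    have h1 : B * X * (s ^ 3 / 2) ≤ 2 * s * (s ^ 3 / 2) := by
      calc B * X * (s ^ 3 / 2) ≤ B * X * (A * C) := by gcongr
        _ = A * B * C * X := by ring
        _ ≤ s ^ 4 := hcon.le
        _ = 2 * s * (s ^ 3 / 2) := by ring
    exact le_of_mul_le_mul_right h1 (by positivity)
  have hA : s * X ≤ 2 * A := by
    have h1 : s * X * s ≤ 2 * A * s := by
      calc s * X * s = s ^ 2 * X := by ring
        _ ≤ A * B * X := by gcongr
        _ = A * (B * X) := by ring
        _ ≤ A * (2 * s) := by gcongr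
        _ = 2 * A * s := by ring
    exact le_of_mul_le_mul_right h1 hs
  have hCX : C * X ≤ s ^ 2 := by
    have h1 : C * X * s ^ 2 ≤ s ^ 2 * s ^ 2 := by
      calc C * X * s ^ 2 ≤ C * X * (A * B) := by gcongr
        _ = A * B * C * X := by ring
        _ ≤ s ^ 4 := hcon.le
        _ = s ^ 2 * s ^ 2 := by ring
    exact le_of_mul_le_mul_right h1 (by positivity)
  have hABX : A * B * X ≤ 4 * s ^ 2 := by
    have h1 : A * B * X * (s ^ 2 / 4) ≤ 4 * s ^ 2 * (s ^ 2 / 4) := by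
      calc A * B * X * (s ^ 2 / 4) ≤ A * B * X * C := by gcongr
        _ = A * B * C * X := by ring
        _ ≤ s ^ 4 := hcon.le
        _ = 4 * s ^ 2 * (s ^ 2 / 4) := by ring
    exact le_of_mul_le_mul_right h1 (by positivity)
  have hK0 : X ≤ 4 * K0 := by
    have h1 : X * s ^ 2 ≤ 4 * K0 * s ^ 2 := by
      calc X * s ^ 2 = A * B * X * K0 := by rw [g0]; ring
        _ ≤ 4 * s ^ 2 * K0 := by gcongr
        _ = 4 * K0 * s ^ 2 := by ring
    exact le_of_mul_le_mul_right h1 (by positivity)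
  -- c is small compared with a, which separates c from a, and small enough that k(c) keeps the size
  -- of k(0).
  have hC' : C * X ≤ X * (X * s) / 48 := by
    have := mul_le_mul_of_nonneg_left hsX hs.le
    linarith
  have hC2 : 48 * C ≤ X * s := by
    have : (48 * C) * X ≤ X * s * X := by linarith
    exact le_of_mul_le_mul_right this hX
  have hs2 : s ≤ 1 := by linarith
  have hKc : X ≤ 8 * Kc := by
    have := mul_le_of_le_one_right hX.le hs2
    linarith
  have hdac : s * X ≤ 4 * dac := by linarith
  have hp : s * X ≤ 8 * p := by linarith
  -- Now g(c) = ε pins b to c, and b inherits the distance of c from a.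
  have hpk : s * X * X * r ≤ 64 * e := by
    rw [gc]
    calc s * X * X * r ≤ (8 * p) * (8 * Kc) * r := by gcongr
      _ = 64 * (p * r * Kc) := by ring
  have her : e ≤ r := by
    rw [gc]
    calc p * r * Kc ≤ 1 * r * 1 := by gcongr
      _ = r := by ring
  have hr : 16 * r ≤ s * X := by
    have h1 : 16 * r * (s * X * X) ≤ s * X * (s * X * X) := by linarith
    exact le_of_mul_le_mul_right h1 (by positivity)
  have hq : s * X ≤ 16 * q := by linarith
  -- Since r ≥ |ε|, the value f(b) = ρ makes l(b) small, while the size of f(0) makes it large: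
  -- 8|l(b)| would lie between 3s³ and 2s³.
  have hR : s * X * e * Lb ≤ 16 * R := by
    rw [fb]
    calc s * X * e * Lb ≤ 16 * q * r * Lb := by gcongr
      _ = 16 * (q * r * Lb) := by ring
  have hABC : A * B * C ≤ s ^ 3 / 48 := by
    have h1 : A * B * C * X ≤ s ^ 3 / 48 * X := by
      calc A * B * C * X ≤ s ^ 4 := hcon.le
        _ = s ^ 3 * s := by ring
        _ ≤ s ^ 3 * (X / 48) := by gcongr; linarith
        _ = _ := by ring
    exact le_of_mul_le_mul_right h1 hX
  have hLb : 3 * s ^ 3 ≤ 8 * Lb := by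
    have h1 : A * C * Lb ≤ Lb := mul_le_of_le_one_left nlb (mul_le_one₀ ha.le nC hc.le)
    have h2 : s ^ 3 / 2 ≤ A * C * (Lb + 2 * B) := by
      refine hf0.trans ?_
      rw [f0]; gcongr
    have h3 : A * C * (Lb + 2 * B) = A * C * Lb + 2 * (A * B * C) := by ring
    linarith [pow_pos hs 3]
  have h1 : s * X * e * (3 * s ^ 3) ≤ s * X * e * (8 * Lb) := by gcongr
  have h2 : 0 < s ^ 4 * X * e := by positivity
  have h3 : s * X * e * (3 * s ^ 3) = 3 * (s ^ 4 * X * e) := by ring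
  linarith

/-! ### Maximum principle for plurisubharmonic functions along curves -/

/-- An integrable real majorant makes both of its own half-integrals finite, so no ∞ - ∞ arises;
monotonicity of the lower integral needs no measurability of `u`. -/
theorem circleMean_le_coe {E : Type*} [NormedAddCommGroup E] [NormedSpace ℂ E] {u : E → EReal}
    {a b : E} {g : ℝ → ℝ} (hg : IntervalIntegrable g volume 0 (2 * Real.pi))
    (h : ∀ θ : ℝ, u (a + Complex.exp ((θ : ℂ) * Complex.I) • b) ≤ (g θ : EReal)) :
    circleMean u a b ≤ (((2 * Real.pi)⁻¹ * ∫ θ in 0..2 * Real.pi, g θ : ℝ) : EReal) := by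
  have hpi : (0 : ℝ) < 2 * Real.pi := by positivity
  have hgI : Integrable g (volume.restrict (Ioc 0 (2 * Real.pi))) :=
    (intervalIntegrable_iff_integrableOn_Ioc_of_le hpi.le).mp hg
  set μ := volume.restrict (Ioc 0 (2 * Real.pi)) with hμ
  have e1 : ∫⁻ θ, ENNReal.ofReal (g θ) ∂μ ≠ ⊤ := (hgI.lintegral_lt_top).ne
  have e2 : ∫⁻ θ, ENNReal.ofReal (-g θ) ∂μ ≠ ⊤ := (hgI.neg.lintegral_lt_top).ne
  have c : ENNReal.ofReal (2 * Real.pi) ≠ 0 := by simpa using hpi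
  rw [intervalIntegral.integral_of_le hpi.le,
    integral_eq_lintegral_pos_part_sub_lintegral_neg_part hgI, mul_sub, EReal.coe_sub]
  unfold circleMean
  have key : ∀ x : ENNReal, x ≠ ⊤ → (((2 * Real.pi)⁻¹ * x.toReal : ℝ) : EReal)
      = (((ENNReal.ofReal (2 * Real.pi))⁻¹ * x : ENNReal) : EReal) := fun x hx => by
    rw [← EReal.coe_ennreal_toReal (ENNReal.mul_ne_top (ENNReal.inv_ne_top.mpr c) hx),
      ENNReal.toReal_mul, ENNReal.toReal_inv, ENNReal.toReal_ofReal hpi.le]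
  rw [key _ e1, key _ e2]
  refine EReal.sub_le_sub ?_ ?_
  · rw [EReal.coe_ennreal_le_coe_ennreal_iff]
    gcongr with θ
    simpa using EReal.toENNReal_le_toENNReal (h θ)
  · rw [EReal.coe_ennreal_le_coe_ennreal_iff]
    gcongr with θ
    have := EReal.toENNReal_le_toENNReal (EReal.neg_le_neg_iff.mpr (h θ))
    rwa [← EReal.coe_neg, EReal.real_coe_toENNReal] at this

theorem IsPlurisubharmonicOn.le_circleAverage {E : Type*} [NormedAddCommGroup E] [NormedSpace ℂ E]
    {u : E → EReal} {Ω : Set E} (hu : IsPlurisubharmonicOn u Ω) {w b : E} {τ : ℂ} {r : ℝ}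
    (hr : 0 ≤ r) (hΩ : ∀ ζ ∈ Metric.closedBall (0 : ℂ) r, w + ζ • b ∈ Ω) {G : ℂ → ℝ}
    (hG : CircleIntegrable G τ r)
    (h : ∀ ζ : ℂ, ‖ζ‖ = r → u (w + ζ • b) ≤ (G (τ + ζ) : EReal)) :
    u w ≤ ((Real.circleAverage G τ r : ℝ) : EReal) := by
  refine (hu.le_circleMean w ((r : ℂ) • b) fun ζ hζ => ?_).trans ?_
  · rw [smul_smul]
    refine hΩ _ ?_
    rw [mem_closedBall_zero_iff, norm_mul, Complex.norm_real, Real.norm_of_nonneg hr]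
    exact mul_le_of_le_one_left hr hζ
  · rw [Real.circleAverage_def, smul_eq_mul]
    refine circleMean_le_coe hG fun θ => ?_
    rw [smul_smul, mul_comm]
    exact h _ (by rw [norm_mul, Complex.norm_real, Complex.norm_exp_ofReal_mul_I, mul_one,
      Real.norm_of_nonneg hr])

theorem norm_sub_sq_complex (x y : ℂ) :
    ‖x - y‖ ^ 2 = ‖x‖ ^ 2 - 2 * ((starRingEnd ℂ) x * y).re + ‖y‖ ^ 2 := by
  simp only [← Complex.normSq_eq_norm_sq, Complex.normSq_apply, Complex.sub_re, Complex.sub_im,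
    Complex.mul_re, Complex.conj_re, Complex.conj_im]
  ring

/-- A plurisubharmonic function penalised by the squared distance to a holomorphic curve, minus a
strictly superharmonic function of the parameter, has no local maximum along the direction of the
tangent of the curve. -/
theorem IsPlurisubharmonicOn.not_eventually_penalized_le {u : ℂ × ℂ → EReal} {Ω : Set (ℂ × ℂ)}
    (hu : IsPlurisubharmonicOn u Ω) {φ₁ φ₂ : ℂ → ℂ} (hφ₁ : Differentiable ℂ φ₁)
    (hφ₂ : Differentiable ℂ φ₂) {h : ℂ → ℝ} {τ : ℂ} (hh : InnerProductSpace.HarmonicAt h τ)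
    {w : ℂ × ℂ} {U s n : ℝ} (hs : 0 < s) (hn : 0 < n) (hU : u w = (U : EReal))
    (hΩ : ∀ᶠ ζ : ℂ in 𝓝 0, w + ζ • (deriv φ₁ τ, deriv φ₂ τ) ∈ Ω)
    (hmax : ∀ᶠ ζ : ℂ in 𝓝 0, u (w + ζ • (deriv φ₁ τ, deriv φ₂ τ)) ≤
      ((U + (s * ‖τ‖ ^ 2 - h τ - n * (‖w.1 - φ₁ τ‖ ^ 2 + ‖w.2 - φ₂ τ‖ ^ 2))
        - (s * ‖τ + ζ‖ ^ 2 - h (τ + ζ) -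
          n * (‖w.1 + ζ * deriv φ₁ τ - φ₁ (τ + ζ)‖ ^ 2
            + ‖w.2 + ζ * deriv φ₂ τ - φ₂ (τ + ζ)‖ ^ 2)) : ℝ) : EReal)) : False := by
  set q : (ℂ → ℂ) → ℂ → ℂ := fun φ ζ => φ (τ + ζ) - φ τ - ζ * deriv φ τ with hq
  -- κ is chosen so that the quadratic errors n|q|² cost at most s r²/4 of the gain s r².
  set κ : ℝ := min 1 (s / (8 * n)) with hκ
  have hκ0 : 0 < κ := by positivity
  have hκ2 : n * (κ ^ 2 + κ ^ 2) ≤ s / 4 := by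
    have h1 : κ ≤ 1 := min_le_left _ _
    have h2 : κ * (8 * n) ≤ s := (le_div_iff₀ (by positivity)).mp (min_le_right _ _)
    have h3 : κ ^ 2 ≤ κ := by nlinarith
    nlinarith
  have hqs : ∀ φ : ℂ → ℂ, Differentiable ℂ φ → ∀ᶠ ζ : ℂ in 𝓝 0, ‖q φ ζ‖ ≤ κ * ‖ζ‖ :=
    fun φ hφ => by
      have := (hasDerivAt_iff_isLittleO_nhds_zero.mp (hφ τ).hasDerivAt).def hκ0
      simpa [hq, smul_eq_mul] using this
  have hhn : ∀ᶠ ζ : ℂ in 𝓝 0, InnerProductSpace.HarmonicAt h (τ + ζ) := by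
    have : Tendsto (fun ζ : ℂ => τ + ζ) (𝓝 0) (𝓝 τ) := by
      have : Continuous fun ζ : ℂ => τ + ζ := by fun_prop
      simpa using this.tendsto 0
    exact this.eventually hh.eventually
  obtain ⟨r, hr, hball⟩ := Metric.nhds_basis_closedBall.eventually_iff.mp
    (hΩ.and (hmax.and ((hqs φ₁ hφ₁).and ((hqs φ₂ hφ₂).and hhn))))
  -- Expanding the squares leaves cross terms that are real parts of holomorphic functions of the
  -- parameter, hence harmonic. The majorant `G` is then harmonic with value U - s r²/2 < U at the
  -- centre.
  set e : ℂ → ℂ := fun x => -(2 * s : ℝ) * ((starRingEnd ℂ) τ * (x - τ))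
    - (2 * n : ℝ) * ((starRingEnd ℂ) (w.1 - φ₁ τ) * q φ₁ (x - τ)
      + (starRingEnd ℂ) (w.2 - φ₂ τ) * q φ₂ (x - τ)) with he
  have hed : Differentiable ℂ e := by
    simp only [he, hq]
    fun_prop
  set G : ℂ → ℝ := fun x => h x + (e x).re + (U - h τ - s / 2 * r ^ 2) with hG
  have hGh : InnerProductSpace.HarmonicOnNhd G (Metric.closedBall τ |r|) := fun x hx => by
    have h1 : InnerProductSpace.HarmonicAt h x := by
      have := (hball (show x - τ ∈ Metric.closedBall 0 r by
        rw [abs_of_pos hr] at hx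
        simpa [dist_eq_norm] using hx)).2.2.2.2
      simpa using this
    exact (h1.add (hed.analyticAt x).harmonicAt_re).add
      (InnerProductSpace.harmonicAt_const _)
  have hle := hu.le_circleAverage (w := w) (b := (deriv φ₁ τ, deriv φ₂ τ)) (τ := τ) (G := G) hr.le
    (fun ζ hζ => (hball hζ).1)
    ((hGh.continuousOn.mono Metric.sphere_subset_closedBall).circleIntegrable') ?_
  · rw [hGh.circleAverage_eq, hU, EReal.coe_le_coe_iff] at hle
    simp only [hG, he, hq] at hle
    simp at hle
    nlinarith [pow_pos hr 2]
  · intro ζ hζ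
    obtain ⟨-, h1, h2, h3, -⟩ := hball (show ζ ∈ Metric.closedBall 0 r by simp [hζ])
    refine h1.trans ?_
    rw [EReal.coe_le_coe_iff]
    have a1 : w.1 + ζ * deriv φ₁ τ - φ₁ (τ + ζ) = (w.1 - φ₁ τ) - q φ₁ ζ := by
      simp only [hq]; ring
    have a2 : w.2 + ζ * deriv φ₂ τ - φ₂ (τ + ζ) = (w.2 - φ₂ τ) - q φ₂ ζ := by
      simp only [hq]; ring
    have a3 : ‖τ + ζ‖ ^ 2 = ‖τ‖ ^ 2 + 2 * ((starRingEnd ℂ) τ * ζ).re + ‖ζ‖ ^ 2 := by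
      have := norm_sub_sq_complex τ (-ζ)
      simp only [sub_neg_eq_add, mul_neg, Complex.neg_re, norm_neg] at this
      linarith
    rw [a1, a2, a3, norm_sub_sq_complex _ (q φ₁ ζ), norm_sub_sq_complex _ (q φ₂ ζ), hζ]
    have b1 : ‖q φ₁ ζ‖ ^ 2 ≤ κ ^ 2 * r ^ 2 := by
      rw [← mul_pow]; rw [hζ] at h2; gcongr
    have b2 : ‖q φ₂ ζ‖ ^ 2 ≤ κ ^ 2 * r ^ 2 := by
      rw [← mul_pow]; rw [hζ] at h3; gcongr
    have b3 : n * (‖q φ₁ ζ‖ ^ 2 + ‖q φ₂ ζ‖ ^ 2) ≤ s / 4 * r ^ 2 := by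
      calc n * (‖q φ₁ ζ‖ ^ 2 + ‖q φ₂ ζ‖ ^ 2) ≤ n * (κ ^ 2 * r ^ 2 + κ ^ 2 * r ^ 2) := by gcongr
        _ = n * (κ ^ 2 + κ ^ 2) * r ^ 2 := by ring
        _ ≤ _ := by gcongr
    have b4 : (e (τ + ζ)).re = -(2 * s) * ((starRingEnd ℂ) τ * ζ).re
        - 2 * n * (((starRingEnd ℂ) (w.1 - φ₁ τ) * q φ₁ ζ).re
          + ((starRingEnd ℂ) (w.2 - φ₂ τ) * q φ₂ ζ).re) := by
      simp only [he, add_sub_cancel_left]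
      rw [← Complex.ofReal_neg, Complex.sub_re, Complex.re_ofReal_mul, Complex.re_ofReal_mul,
        Complex.add_re]
    simp only [hG]
    rw [b4]
    nlinarith [pow_pos hr 2]

/-- Maximum principle along a holomorphic curve: a plurisubharmonic function restricted to the
curve is below a harmonic function on a compact set of parameters if it is on the boundary. -/
theorem IsPlurisubharmonicOn.comp_le_of_le_boundary {u : ℂ × ℂ → EReal} {Ω : Set (ℂ × ℂ)}
    (hu : IsPlurisubharmonicOn u Ω) (hΩ : IsOpen Ω) {φ₁ φ₂ : ℂ → ℂ} (hφ₁ : Differentiable ℂ φ₁)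
    (hφ₂ : Differentiable ℂ φ₂) {K : Set ℂ} (hK : IsCompact K)
    (hmaps : ∀ τ ∈ K, (φ₁ τ, φ₂ τ) ∈ Ω) {h : ℂ → ℝ} (hh : InnerProductSpace.HarmonicOnNhd h K)
    (hbd : ∀ τ ∈ K, τ ∉ interior K → u (φ₁ τ, φ₂ τ) ≤ (h τ : EReal)) :
    ∀ τ ∈ K, u (φ₁ τ, φ₂ τ) ≤ (h τ : EReal) := by
  intro t ht
  by_contra! hcon
  obtain ⟨R, hR⟩ := hK.bddAbove_image (f := fun τ : ℂ => ‖τ‖ ^ 2) (by fun_prop)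
  have hR : ∀ τ ∈ K, ‖τ‖ ^ 2 ≤ R := fun τ hτ => hR ⟨τ, hτ, rfl⟩
  have hR0 : 0 ≤ R := (sq_nonneg _).trans (hR t ht)
  obtain ⟨c, hc1, hc2⟩ := EReal.lt_iff_exists_real_btwn.mp hcon
  rw [EReal.coe_lt_coe_iff] at hc1
  -- s|τ|² makes the maximum strict, yet stays below the gap c - h(t) on all of `K`.
  set s : ℝ := (c - h t) / (2 * (R + 1)) with hs
  have hs0 : 0 < s := div_pos (by linarith) (by positivity)
  have hsR : s * R < c - h t := by
    have : s * (2 * (R + 1)) = c - h t := div_mul_cancel₀ _ (by positivity)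
    nlinarith
  have hφ : Continuous fun τ => (φ₁ τ, φ₂ τ) := hφ₁.continuous.prodMk hφ₂.continuous
  obtain ⟨d, hd, hdΩ⟩ := (hK.image hφ).exists_cthickening_subset_open hΩ (by
    rintro _ ⟨τ, hτ, rfl⟩; exact hmaps τ hτ)
  set L := Metric.cthickening d ((fun τ => (φ₁ τ, φ₂ τ)) '' K) with hL
  have hLc : IsCompact L := (hK.image hφ).cthickening
  set ψ : ℂ × (ℂ × ℂ) → ℝ := fun p => ‖p.2.1 - φ₁ p.1‖ ^ 2 + ‖p.2.2 - φ₂ p.1‖ ^ 2 with hψ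
  have hψc : Continuous ψ := by
    have := hφ₁.continuous
    have := hφ₂.continuous
    fun_prop
  -- Doubling of variables: the point w is freed from the curve and the distance to φ(τ) is
  -- penalised, so that only affine discs in w are used.
  set Φ : ℝ → ℂ × (ℂ × ℂ) → EReal := fun n p =>
    u p.2 + ((s * ‖p.1‖ ^ 2 - h p.1 - n * ψ p : ℝ) : EReal) with hΦ
  have husc : ∀ n, UpperSemicontinuousOn (Φ n) (K ×ˢ L) := fun n => by
    refine UpperSemicontinuousOn.add' ?_ ?_ ?_
    · intro p hp y hy
      have h1 := hu.upperSemicontinuousOn p.2 (hdΩ hp.2) y hy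
      have h2 : Tendsto (Prod.snd : ℂ × (ℂ × ℂ) → ℂ × ℂ) (𝓝[K ×ˢ L] p) (𝓝[Ω] p.2) :=
        continuous_snd.continuousWithinAt.tendsto_nhdsWithin fun x hx => hdΩ hx.2
      exact h2.eventually h1
    · refine ContinuousOn.upperSemicontinuousOn ?_
      refine continuous_coe_real_ereal.comp_continuousOn ?_
      have := hh.continuousOn.comp (continuous_fst.continuousOn (s := K ×ˢ L))
        fun x hx => hx.1
      exact ((by fun_prop : Continuous fun p : ℂ × (ℂ × ℂ) => s * ‖p.1‖ ^ 2).continuousOn.sub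
        this).sub (continuous_const.mul hψc).continuousOn
    · intro p hp
      exact EReal.continuousAt_add (.inr (EReal.coe_ne_bot _)) (.inr (EReal.coe_ne_top _))
  have htL : ∀ τ ∈ K, (φ₁ τ, φ₂ τ) ∈ L := fun τ hτ =>
    Metric.self_subset_cthickening _ ⟨τ, hτ, rfl⟩
  have hKL := hK.prod hLc
  have hne : (K ×ˢ L).Nonempty := ⟨(t, (φ₁ t, φ₂ t)), ht, htL t ht⟩
  have hreal : ∀ n : ℝ, ∀ x : ℝ, ∀ p ∈ K ×ˢ L, (x : EReal) < Φ n p → ∃ U : ℝ, u p.2 = U := by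
    intro n x p hp hx
    have h1 : u p.2 ≠ ⊤ := (hu.lt_top _ (hdΩ hp.2)).ne
    have h2 : u p.2 ≠ ⊥ := fun hbot => by
      simp only [hΦ, hbot, EReal.bot_add] at hx
      exact not_lt_bot hx
    exact ⟨(u p.2).toReal, (EReal.coe_toReal h1 h2).symm⟩
  have hΦt : ∀ n, ((c - h t : ℝ) : EReal) < Φ n (t, (φ₁ t, φ₂ t)) := fun n => by
    have h1 : ψ (t, (φ₁ t, φ₂ t)) = 0 := by simp [hψ]
    have h2 : u (φ₁ t, φ₂ t) ≠ ⊤ := (hu.lt_top _ (hmaps t ht)).ne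
    rw [← EReal.coe_toReal h2 (ne_bot_of_gt hc2), EReal.coe_lt_coe_iff] at hc2
    simp only [hΦ, h1]
    rw [← EReal.coe_toReal h2 (ne_bot_of_gt hcon), ← EReal.coe_add, EReal.coe_lt_coe_iff]
    have : 0 ≤ s * ‖t‖ ^ 2 := by positivity
    linarith
  obtain ⟨p₀, hp₀, hmax₀⟩ := (husc 0).exists_isMaxOn hne hKL
  obtain ⟨M, hM⟩ : ∃ M : ℝ, Φ 0 p₀ ≤ M := by
    obtain ⟨U, hU⟩ := hreal 0 _ p₀ hp₀ ((hΦt 0).trans_le (hmax₀ ⟨ht, htL t ht⟩))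
    refine ⟨U + (s * ‖p₀.1‖ ^ 2 - h p₀.1 - 0 * ψ p₀), ?_⟩
    simp only [hΦ, hU]
    rw [← EReal.coe_add]
  -- Candidates for the maximum where a joint displacement of τ and w could leave K × L. The
  -- boundary hypothesis keeps them off the curve, so by compactness one large n excludes them all.
  set bad : Set (ℂ × (ℂ × ℂ)) := ((K ×ˢ L) ∩ (Φ 0) ⁻¹' Ici ((c - h t : ℝ) : EReal)) ∩
    {p | p.1 ∈ interior K ∧ ‖p.2 - (φ₁ p.1, φ₂ p.1)‖ < d}ᶜ with hbad
  have hbadc : IsCompact bad := by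
    refine ((husc 0).isCompact_inter_preimage_Ici hKL _).inter_right ?_
    refine (IsOpen.inter ?_ ?_).isClosed_compl
    · exact isOpen_interior.preimage continuous_fst
    · exact isOpen_lt (continuous_snd.sub (hφ.comp continuous_fst)).norm continuous_const
  have hψbad : ∀ p ∈ bad, 0 < ψ p := by
    rintro ⟨τ, w⟩ ⟨⟨hp, hc⟩, hp2⟩
    refine lt_of_le_of_ne (by positivity) fun h0 => ?_
    have h1 : 0 ≤ ‖w.1 - φ₁ τ‖ ^ 2 := by positivity
    have h2 : 0 ≤ ‖w.2 - φ₂ τ‖ ^ 2 := by positivity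
    simp only [hψ] at h0
    have h3 : w.1 = φ₁ τ := by
      rw [← sub_eq_zero, ← norm_eq_zero]; exact pow_eq_zero_iff two_ne_zero |>.mp (by linarith)
    have h4 : w.2 = φ₂ τ := by
      rw [← sub_eq_zero, ← norm_eq_zero]; exact pow_eq_zero_iff two_ne_zero |>.mp (by linarith)
    obtain rfl : w = (φ₁ τ, φ₂ τ) := Prod.ext h3 h4
    have h5 : τ ∉ interior K := fun h5 => hp2 ⟨h5, by simpa using hd⟩
    have h6 : ((c - h t : ℝ) : EReal) ≤ ((h τ : ℝ) : EReal) + ((s * ‖τ‖ ^ 2 - h τ : ℝ) : EReal) := by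
      refine (mem_Ici.mp hc).trans ?_
      simp only [hΦ, zero_mul, sub_zero]
      gcongr
      exact hbd τ hp.1 h5
    rw [← EReal.coe_add, EReal.coe_le_coe_iff] at h6
    have := mul_le_mul_of_nonneg_left (hR τ hp.1) hs0.le
    linarith
  obtain ⟨n, hn, hnψ⟩ : ∃ n : ℝ, 0 < n ∧ ∀ p ∈ bad, M - (c - h t) < n * ψ p := by
    rcases bad.eq_empty_or_nonempty with hb | hb
    · exact ⟨1, one_pos, by simp [hb]⟩
    · obtain ⟨p, hp, hmin⟩ := hbadc.exists_isMinOn hb hψc.continuousOn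
      have hm := hψbad p hp
      refine ⟨(|M - (c - h t)| + 1) / ψ p, by positivity, fun p' hp' => ?_⟩
      calc M - (c - h t) < |M - (c - h t)| + 1 := by linarith [le_abs_self (M - (c - h t))]
        _ = (|M - (c - h t)| + 1) / ψ p * ψ p := (div_mul_cancel₀ _ hm.ne').symm
        _ ≤ _ := by gcongr; exact hmin hp'
  obtain ⟨⟨τ, w⟩, hp, hmax⟩ := (husc n).exists_isMaxOn hne hKL
  have hp' : ((c - h t : ℝ) : EReal) < Φ n (τ, w) := (hΦt n).trans_le (hmax ⟨ht, htL t ht⟩)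
  obtain ⟨U, hU⟩ := hreal n _ _ hp hp'
  simp only at hU
  have hgood : τ ∈ interior K ∧ ‖w - (φ₁ τ, φ₂ τ)‖ < d := by
    by_contra hng
    have h1 : Φ 0 (τ, w) ≤ M := (hmax₀ hp).trans hM
    simp only [hΦ, hU, ← EReal.coe_add, EReal.coe_le_coe_iff, EReal.coe_lt_coe_iff] at h1 hp'
    have h0 : 0 ≤ n * ψ (τ, w) := by positivity
    have h2 : (τ, w) ∈ bad := by
      refine ⟨⟨hp, mem_preimage.mpr (mem_Ici.mpr ?_)⟩, hng⟩
      simp only [hΦ, hU, ← EReal.coe_add, EReal.coe_le_coe_iff]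
      linarith
    have := hnψ _ h2
    linarith
  -- Moving τ by ζ and w by ζφ'(τ) changes w - φ(τ) only to order o(ζ).
  have hnhds : ∀ᶠ ζ : ℂ in 𝓝 0, (τ + ζ, w + ζ • (deriv φ₁ τ, deriv φ₂ τ)) ∈ K ×ˢ L := by
    have h1 : Continuous fun ζ : ℂ => τ + ζ := by fun_prop
    have h2 : Continuous fun ζ : ℂ => ‖w + ζ • (deriv φ₁ τ, deriv φ₂ τ) - (φ₁ τ, φ₂ τ)‖ := by
      fun_prop
    have h3 : ∀ᶠ ζ : ℂ in 𝓝 0, τ + ζ ∈ interior K :=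
      h1.continuousAt.eventually_mem (isOpen_interior.mem_nhds (by simpa using hgood.1))
    have h4 := h2.continuousAt.eventually_lt continuousAt_const
      (show ‖w + (0 : ℂ) • (deriv φ₁ τ, deriv φ₂ τ) - (φ₁ τ, φ₂ τ)‖ < d by simpa using hgood.2)
    filter_upwards [h3, h4] with ζ h5 h6
    refine ⟨interior_subset h5, Metric.mem_cthickening_of_dist_le _ _ _ _ ⟨τ, hp.1, rfl⟩ ?_⟩
    rw [dist_eq_norm]
    exact h6.le
  refine hu.not_eventually_penalized_le hφ₁ hφ₂ (hh τ hp.1) hs0 hn hU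
    (hnhds.mono fun ζ hζ => hdΩ hζ.2) (hnhds.mono fun ζ hζ => ?_)
  have h1 := hmax hζ
  simp only [hΦ, hψ, mem_ofPred_eq, hU] at h1
  rw [← EReal.coe_add] at h1
  rw [EReal.coe_sub]
  refine EReal.le_sub_iff_add_le (.inl (EReal.coe_ne_bot _)) (.inl (EReal.coe_ne_top _)) |>.mpr ?_
  exact h1

/-! ### Logarithmic poles along a rational cubic -/

theorem isOpen_bidisk : IsOpen bidisk := Metric.isOpen_ball.prod Metric.isOpen_ball

theorem log_enorm_le_coe_log {E : Type*} [NormedAddCommGroup E] {x : E} {r : ℝ} (hr : 0 < r)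
    (h : ‖x‖ ≤ r) : ENNReal.log ‖x‖ₑ ≤ (Real.log r : EReal) := by
  rw [← ENNReal.log_ofReal_of_pos hr, ← ofReal_norm]
  exact ENNReal.log_le_log (ENNReal.ofReal_le_ofReal h)

theorem log_enorm_eq_coe_log {E : Type*} [NormedAddCommGroup E] {x : E} (hx : x ≠ 0) :
    ENNReal.log ‖x‖ₑ = (Real.log ‖x‖ : EReal) := by
  rw [← ofReal_norm, ENNReal.log_ofReal_of_pos (norm_pos_iff.mpr hx)]

/-- If at most one of `x`, `y`, `w` is small, their minimum is controlled by their product. -/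
theorem exists_le_mul_of_separated {x y w e m : ℝ} (hx : 0 ≤ x) (hy : 0 ≤ y) (hw : 0 ≤ w)
    (he : 0 < e) (hm : 0 < m) (hm1 : m ≤ 1)
    (h1 : m ≤ x + y) (h2 : e ≤ x * y + w) :
    x ≤ 4 / (m * e) * (x * y * w) ∨ y ≤ 4 / (m * e) * (x * y * w) ∨
      w ≤ 4 / (m * e) * (x * y * w) := by
  have hme : 0 < m * e := by positivity
  simp only [div_mul_eq_mul_div, le_div_iff₀ hme]
  rcases le_total (e / 2) w with h3 | h3
  · rcases le_total (m / 2) y with h4 | h4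
    · left
      have := mul_le_mul h4 h3 (by positivity) hy
      nlinarith
    · right; left
      have := mul_le_mul (show m / 2 ≤ x by linarith) h3 (by positivity) hx
      nlinarith
  · right; right
    have h4 : e / 2 ≤ x * y := by linarith
    have h5 : w * (e / 2) ≤ w * (x * y) := by gcongr
    have h6 : w * (m * e) ≤ w * (1 * e) := by gcongr
    nlinarith [mul_nonneg hw (mul_nonneg hx hy)]

section Cubic

variable {k η ε : ℂ}

theorem norm_quadratic_le (hη : ‖η‖ ≤ 1 / 8) (hε : ‖ε‖ ≤ 1 / 8) {τ : ℂ} (hτ : ‖τ‖ ≤ 1 / 2) :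
    ‖τ * (τ - η) - ε‖ ≤ 7 / 16 ∧ ‖τ - η‖ ≤ 5 / 8 := by
  have h1 : ‖τ - η‖ ≤ 5 / 8 := (norm_sub_le _ _).trans (by linarith)
  refine ⟨?_, h1⟩
  refine (norm_sub_le _ _).trans ?_
  rw [norm_mul]
  nlinarith [norm_nonneg τ, norm_nonneg (τ - η)]

theorem cubic_mem_bidisk (hk : ‖k‖ ≤ 2) (hη : ‖η‖ ≤ 1 / 8) (hε : ‖ε‖ ≤ 1 / 8) {τ : ℂ}
    (hτ : ‖τ‖ ≤ 1 / 2) : (k * τ * (τ * (τ - η) - ε), τ * (τ - η)) ∈ bidisk := by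
  obtain ⟨h1, h2⟩ := norm_quadratic_le hη hε hτ
  refine ⟨?_, ?_⟩
  · rw [mem_ball_zero_iff, norm_mul, norm_mul]
    calc ‖k‖ * ‖τ‖ * ‖τ * (τ - η) - ε‖ ≤ 2 * (1 / 2) * (7 / 16) := by gcongr
      _ < 1 := by norm_num
  · rw [mem_ball_zero_iff, norm_mul]
    calc ‖τ‖ * ‖τ - η‖ ≤ 1 / 2 * (5 / 8) := by gcongr
      _ < 1 := by norm_num

/-- Along the rational cubic through the three poles, the distance to the nearest pole is
controlled by the polynomial that vanishes at the four preimages of the poles. -/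
theorem exists_norm_cubic_sub_le (hk : ‖k‖ ≤ 2) (hη : ‖η‖ ≤ 1 / 8) (hε : ‖ε‖ ≤ 1 / 8)
    (hη0 : η ≠ 0) (hε0 : ε ≠ 0) {a : Fin 3 → ℂ × ℂ}
    (ha : a = ![(0, 0), (-(k * η * ε), 0), (0, ε)]) {τ : ℂ} (hτ : ‖τ‖ ≤ 1 / 2) :
    ∃ j, ‖(k * τ * (τ * (τ - η) - ε), τ * (τ - η)) - a j‖ ≤
      4 / (‖η‖ * ‖ε‖) * ‖τ * (τ - η) * (τ * (τ - η) - ε)‖ := by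
  obtain ⟨h1, h2⟩ := norm_quadratic_le hη hε hτ
  have hm : ‖η‖ ≤ ‖τ‖ + ‖τ - η‖ := by
    have := norm_sub_le τ (τ - η)
    rwa [sub_sub_cancel] at this
  have he : ‖ε‖ ≤ ‖τ‖ * ‖τ - η‖ + ‖τ * (τ - η) - ε‖ := by
    have := norm_sub_le (τ * (τ - η)) (τ * (τ - η) - ε)
    rwa [sub_sub_cancel, norm_mul] at this
  have key := exists_le_mul_of_separated (norm_nonneg _) (norm_nonneg _) (norm_nonneg _)
    (norm_pos_iff.mpr hε0) (norm_pos_iff.mpr hη0) (by linarith) hm he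
  rw [norm_mul, norm_mul]
  subst ha
  rcases key with h | h | h
  · refine ⟨0, le_trans ?_ h⟩
    simp only [Matrix.cons_val_zero, Prod.mk_sub_mk, sub_zero, Prod.norm_mk, norm_mul]
    refine max_le ?_ (mul_le_of_le_one_right (norm_nonneg _) (by linarith))
    calc ‖k‖ * ‖τ‖ * ‖τ * (τ - η) - ε‖ ≤ 2 * ‖τ‖ * (1 / 2) := by gcongr; linarith
      _ = ‖τ‖ := by ring
  · refine ⟨1, le_trans ?_ h⟩
    have e1 : k * τ * (τ * (τ - η) - ε) - -(k * η * ε) = k * (τ ^ 2 - ε) * (τ - η) := by ring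
    simp only [Matrix.cons_val_one, Matrix.cons_val_zero, Prod.mk_sub_mk, sub_zero, Prod.norm_mk]
    rw [e1, norm_mul, norm_mul, norm_mul]
    have h3 : ‖τ ^ 2 - ε‖ ≤ 1 / 2 := by
      refine (norm_sub_le _ _).trans ?_
      rw [norm_pow]
      nlinarith [norm_nonneg τ]
    refine max_le ?_ (mul_le_of_le_one_left (norm_nonneg _) (by linarith))
    calc ‖k‖ * ‖τ ^ 2 - ε‖ * ‖τ - η‖ ≤ 2 * (1 / 2) * ‖τ - η‖ := by gcongr
      _ = ‖τ - η‖ := by ring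
  · refine ⟨2, le_trans ?_ h⟩
    simp only [Matrix.cons_val, Prod.mk_sub_mk, sub_zero, Prod.norm_mk]
    refine max_le ?_ le_rfl
    rw [norm_mul, norm_mul]
    refine mul_le_of_le_one_left (norm_nonneg _) ?_
    calc ‖k‖ * ‖τ‖ ≤ 2 * (1 / 2) := by gcongr
      _ = 1 := by norm_num

/-- Here |P| ≥ (1/2)(3/8)(1/16) on the circle, so u ≤ 0 ≤ log|P| + log 128 there, with a constant
independent of the poles. -/
theorem one_le_norm_quartic (hη : ‖η‖ ≤ 1 / 8) (hε : ‖ε‖ ≤ 1 / 8) {τ : ℂ} (hτ : ‖τ‖ = 1 / 2) :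
    1 ≤ 128 * ‖τ * (τ - η) * (τ * (τ - η) - ε)‖ := by
  have h1 : 3 / 8 ≤ ‖τ - η‖ := by
    have := norm_sub_norm_le τ η
    linarith
  have h2 : 1 / 16 ≤ ‖τ * (τ - η) - ε‖ := by
    have := norm_sub_norm_le (τ * (τ - η)) ε
    rw [norm_mul, hτ] at this
    linarith
  rw [norm_mul, norm_mul, hτ]
  nlinarith

/-- The constant C' near the poles depends on u and ε. Comparing with (1-σ) log|P| + log 128 absorbs
it where |P| is small, and σ → 0 leaves only the constant from the circle. -/
theorem IsPlurisubharmonicOn.cubic_le (hk : ‖k‖ ≤ 2) (hη : ‖η‖ ≤ 1 / 8) (hε : ‖ε‖ ≤ 1 / 8)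
    (hη0 : η ≠ 0) (hε0 : ε ≠ 0) {a : Fin 3 → ℂ × ℂ}
    (ha : a = ![(0, 0), (-(k * η * ε), 0), (0, ε)]) {u : ℂ × ℂ → EReal}
    (hu : IsPlurisubharmonicOn u bidisk) (hu0 : ∀ w ∈ bidisk, u w ≤ 0)
    (hua : ∀ j, ∃ C : ℝ, ∀ w ∈ bidisk, u w ≤ ENNReal.log ‖w - a j‖ₑ + (C : EReal))
    {t : ℂ} (ht : ‖t‖ ≤ 1 / 2) (hP : t * (t - η) * (t * (t - η) - ε) ≠ 0) :
    u (k * t * (t * (t - η) - ε), t * (t - η)) ≤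
      ((Real.log ‖t * (t - η) * (t * (t - η) - ε)‖ + Real.log 128 : ℝ) : EReal) := by
  set P : ℂ → ℂ := fun τ => τ * (τ - η) * (τ * (τ - η) - ε) with hPdef
  have hPd : Differentiable ℂ P := by simp only [hPdef]; fun_prop
  have hPc : Continuous fun τ => ‖P τ‖ := hPd.continuous.norm
  have hPt : 0 < ‖P t‖ := norm_pos_iff.mpr hP
  choose C hC using hua
  have hM : 0 < 4 / (‖η‖ * ‖ε‖) := by
    have := norm_pos_iff.mpr hη0
    have := norm_pos_iff.mpr hε0
    positivity
  obtain ⟨C', hC'⟩ : ∃ C' : ℝ, ∀ τ : ℂ, ‖τ‖ ≤ 1 / 2 → P τ ≠ 0 →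
      u (k * τ * (τ * (τ - η) - ε), τ * (τ - η)) ≤ ((Real.log ‖P τ‖ + C' : ℝ) : EReal) := by
    refine ⟨Real.log (4 / (‖η‖ * ‖ε‖)) + ∑ j, |C j|, fun τ hτ hPτ => ?_⟩
    obtain ⟨j, hj⟩ := exists_norm_cubic_sub_le hk hη hε hη0 hε0 ha hτ
    have hpos := norm_pos_iff.mpr hPτ
    refine (hC j _ (cubic_mem_bidisk hk hη hε hτ)).trans ?_
    refine (add_le_add_left (log_enorm_le_coe_log (mul_pos hM hpos) hj) _).trans ?_
    rw [← EReal.coe_add, EReal.coe_le_coe_iff, Real.log_mul hM.ne' hpos.ne']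
    have h1 : C j ≤ ∑ j, |C j| := (le_abs_self _).trans
      (Finset.single_le_sum (f := fun j => |C j|) (fun _ _ => abs_nonneg _) (Finset.mem_univ j))
    linarith
  have main : ∀ σ ∈ Ioo (0 : ℝ) 1, u (k * t * (t * (t - η) - ε), t * (t - η)) ≤
      (((1 - σ) * Real.log ‖P t‖ + Real.log 128 : ℝ) : EReal) := by
    rintro σ ⟨hσ0, hσ1⟩
    -- Chosen so that log m + C' ≤ (1-σ) log m + log 128.
    set m : ℝ := min ‖P t‖ (Real.exp ((Real.log 128 - C') / σ)) with hm
    have hm0 : 0 < m := lt_min hPt (Real.exp_pos _)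
    have hmσ : σ * Real.log m + C' ≤ Real.log 128 := by
      have h1 : Real.log m ≤ (Real.log 128 - C') / σ := by
        rw [← Real.log_exp ((Real.log 128 - C') / σ)]
        exact Real.log_le_log hm0 (min_le_right _ _)
      have h2 := (le_div_iff₀ hσ0).mp h1
      linarith
    set K : Set ℂ := Metric.closedBall 0 (1 / 2) ∩ {τ | m ≤ ‖P τ‖} with hK
    have hKc : IsCompact K :=
      (isCompact_closedBall _ _).inter_right (isClosed_le continuous_const hPc)
    have hKn : ∀ τ ∈ K, ‖τ‖ ≤ 1 / 2 := fun τ hτ => by simpa using hτ.1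
    have hKP : ∀ τ ∈ K, P τ ≠ 0 := fun τ hτ => norm_pos_iff.mp (hm0.trans_le hτ.2)
    have hKi : ∀ τ : ℂ, ‖τ‖ < 1 / 2 → m < ‖P τ‖ → τ ∈ interior K := fun τ h1 h2 => by
      refine interior_maximal (t := Metric.ball 0 (1 / 2) ∩ {τ | m < ‖P τ‖}) ?_
        (Metric.isOpen_ball.inter (isOpen_lt continuous_const hPc)) ⟨by simpa using h1, h2⟩
      exact inter_subset_inter Metric.ball_subset_closedBall fun x hx => mem_ofPred.mpr (mem_ofPred.mp hx).le
    refine hu.comp_le_of_le_boundary isOpen_bidisk (φ₁ := fun τ => k * τ * (τ * (τ - η) - ε))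
      (φ₂ := fun τ => τ * (τ - η)) (by fun_prop) (by fun_prop) hKc
      (fun τ hτ => cubic_mem_bidisk hk hη hε (hKn τ hτ))
      (h := fun τ => (1 - σ) * Real.log ‖P τ‖ + Real.log 128) ?_ ?_ t
      ⟨by simpa using ht, mem_ofPred.mpr (min_le_left _ _)⟩
    · intro τ hτ
      exact (((hPd.analyticAt τ).harmonicAt_log_norm (hKP τ hτ)).const_smul
        (c := 1 - σ)).add (InnerProductSpace.harmonicAt_const _)
    · intro τ hτ hτi
      have hpos := norm_pos_iff.mpr (hKP τ hτ)
      rcases (hKn τ hτ).lt_or_eq with h1 | h1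
      · have h2 : ‖P τ‖ = m := le_antisymm (not_lt.mp fun h => hτi (hKi τ h1 h)) hτ.2
        refine (hC' τ (hKn τ hτ) (hKP τ hτ)).trans ?_
        rw [EReal.coe_le_coe_iff, h2]
        linarith
      · refine (hu0 _ (cubic_mem_bidisk hk hη hε (hKn τ hτ))).trans ?_
        rw [← EReal.coe_zero, EReal.coe_le_coe_iff]
        have h2 := Real.log_nonneg (one_le_norm_quartic hη hε h1)
        rw [Real.log_mul (by norm_num) hpos.ne'] at h2
        have h3 : 0 ≤ Real.log (128 : ℝ) := Real.log_nonneg (by norm_num)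
        simp only [hPdef] at *
        nlinarith
  have hlim : Tendsto (fun σ : ℝ => (((1 - σ) * Real.log ‖P t‖ + Real.log 128 : ℝ) : EReal))
      (𝓝[>] 0) (𝓝 ((Real.log ‖P t‖ + Real.log 128 : ℝ) : EReal)) := by
    refine (continuous_coe_real_ereal.tendsto _).comp ?_
    have : Continuous fun σ : ℝ => (1 - σ) * Real.log ‖P t‖ + Real.log 128 := by fun_prop
    simpa using (this.tendsto 0).mono_left nhdsWithin_le_nhds
  refine ge_of_tendsto hlim ?_
  filter_upwards [Ioo_mem_nhdsGT one_pos] with σ hσ using main σ hσ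

end Cubic

/-! ### The two bounds and the conclusion -/

/-- Upper bound of the Green function with poles `(0, 0)`, `(ρ, 0)`, `(0, ε)` when `|ρ|` is much
smaller than `|ε|`. -/
theorem pluricomplexGreen_le_of_three_poles {z : ℂ × ℂ} {ρ ε : ℂ} (hz2 : z.2 ≠ 0) (hz1 : z.1 ≠ 0)
    (hz : ‖z.1‖ ^ 2 ≤ ‖z.2‖ ^ 3) (hq : ‖z.2‖ ≤ 3 / 16) (hε0 : ε ≠ 0) (hρ0 : ρ ≠ 0)
    (hε : 8 * ‖ε‖ ≤ ‖z.2‖) (hρ : 8 * ‖z.2‖ * ‖ρ‖ ≤ ‖z.1‖ * ‖ε‖) :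
    pluricomplexGreen bidisk ![(0, 0), (ρ, 0), (0, ε)] z ≤
      ((2 * Real.log ‖z.2‖ + Real.log 256 : ℝ) : EReal) := by
  obtain ⟨z₁, z₂⟩ := z
  simp only at *
  have nz1 := norm_pos_iff.mpr hz1
  have nz2 := norm_pos_iff.mpr hz2
  have nε := norm_pos_iff.mpr hε0
  have hd1 : 7 / 8 * ‖z₂‖ ≤ ‖z₂ - ε‖ := by
    have := norm_sub_norm_le z₂ ε
    linarith
  have hd2 : ‖z₂ - ε‖ ≤ 2 * ‖z₂‖ := (norm_sub_le _ _).trans (by linarith)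
  have hd0 : z₂ - ε ≠ 0 := norm_pos_iff.mp (by linarith)
  -- With η = -νt, the equations t(t-η) = z₂, kt(z₂-ε) = z₁ and -kηε = ρ determine ν, then t² and k.
  set ν : ℂ := ρ * (z₂ - ε) / (ε * z₁) with hν
  have hν1 : ‖ν‖ ≤ 1 / 4 := by
    rw [hν, norm_div, norm_mul, norm_mul, div_le_iff₀ (by positivity)]
    have : ‖ρ‖ * ‖z₂ - ε‖ ≤ ‖ρ‖ * (2 * ‖z₂‖) := by gcongr
    linarith
  have hν0 : ν ≠ 0 := div_ne_zero (mul_ne_zero hρ0 hd0) (mul_ne_zero hε0 hz1)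
  have hμ1 : 3 / 4 ≤ ‖1 + ν‖ := by
    have := norm_sub_norm_le 1 (-ν)
    rw [norm_neg, norm_one, sub_neg_eq_add] at this
    linarith
  have hμ2 : ‖1 + ν‖ ≤ 5 / 4 := (norm_add_le _ _).trans (by rw [norm_one]; linarith)
  have hμ0 : 1 + ν ≠ 0 := norm_pos_iff.mp (by linarith)
  obtain ⟨t, ht⟩ := IsAlgClosed.exists_pow_nat_eq (z₂ / (1 + ν)) (n := 2) two_pos
  have ht' : t ^ 2 * (1 + ν) = z₂ := by rw [ht, div_mul_cancel₀ _ hμ0]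
  have nt : ‖t‖ ^ 2 * ‖1 + ν‖ = ‖z₂‖ := by rw [← norm_pow, ← norm_mul, ht']
  have ht0 : t ≠ 0 := by
    rintro rfl
    apply hz2
    simpa using ht'.symm
  have nt0 := norm_pos_iff.mpr ht0
  have nt1 : ‖t‖ ≤ 1 / 2 := by nlinarith
  have nt2 : 4 / 5 * ‖z₂‖ ≤ ‖t‖ ^ 2 := by nlinarith [sq_nonneg ‖t‖]
  set k : ℂ := z₁ / (t * (z₂ - ε)) with hk
  set η : ℂ := -(ν * t) with hη
  have hkz : k * t * (z₂ - ε) = z₁ := by rw [hk]; field_simp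
  have hηt : t * (t - η) = z₂ := by rw [hη, ← ht']; ring
  have hρk : ρ = -(k * η * ε) := by rw [hk, hη, hν]; field_simp
  have nη : ‖η‖ ≤ 1 / 8 := by
    rw [hη, norm_neg, norm_mul]
    calc ‖ν‖ * ‖t‖ ≤ 1 / 4 * (1 / 2) := by gcongr
      _ = 1 / 8 := by norm_num
  have hη0 : η ≠ 0 := neg_ne_zero.mpr (mul_ne_zero hν0 ht0)
  have nk : ‖k‖ ≤ 2 := by
    have h1 : ‖k‖ ^ 2 * (‖t‖ ^ 2 * ‖z₂ - ε‖ ^ 2) ≤ ‖z₂‖ ^ 3 := by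
      rw [← mul_pow, ← mul_pow, ← mul_assoc, ← norm_mul, ← norm_mul, hkz]
      exact hz
    have h2 : (4 / 5 * ‖z₂‖) * (7 / 8 * ‖z₂‖) ^ 2 ≤ ‖t‖ ^ 2 * ‖z₂ - ε‖ ^ 2 := by gcongr
    have h3 : ‖k‖ ^ 2 * ((4 / 5 * ‖z₂‖) * (7 / 8 * ‖z₂‖) ^ 2) ≤ ‖z₂‖ ^ 3 :=
      (mul_le_mul_of_nonneg_left h2 (sq_nonneg _)).trans h1
    have h4 : ‖k‖ ^ 2 * (49 / 80) * ‖z₂‖ ^ 3 ≤ 1 * ‖z₂‖ ^ 3 := by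
      calc _ = ‖k‖ ^ 2 * ((4 / 5 * ‖z₂‖) * (7 / 8 * ‖z₂‖) ^ 2) := by ring
        _ ≤ _ := by rw [one_mul]; exact h3
    have h5 := le_of_mul_le_mul_right h4 (by positivity)
    nlinarith [norm_nonneg k]
  have hP : t * (t - η) * (t * (t - η) - ε) ≠ 0 := by
    rw [hηt]; exact mul_ne_zero hz2 hd0
  refine sSup_le ?_
  rintro _ ⟨u, hu, hu0, hua, rfl⟩
  have := hu.cubic_le nk nη (by linarith) hη0 hε0 (by rw [← hρk]) hu0 hua nt1 hP
  rw [hηt, hkz] at this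
  refine this.trans ?_
  rw [EReal.coe_le_coe_iff, norm_mul]
  have h1 : Real.log (‖z₂‖ * ‖z₂ - ε‖) ≤ Real.log (‖z₂‖ * (2 * ‖z₂‖)) := by
    apply Real.log_le_log
    · have := norm_pos_iff.mpr hd0
      positivity
    · gcongr
  rw [Real.log_mul nz2.ne' (mul_pos two_pos nz2).ne', Real.log_mul two_ne_zero nz2.ne'] at h1
  have h2 : Real.log 256 = Real.log 2 + Real.log 128 := by
    rw [← Real.log_mul (by norm_num) (by norm_num)]; norm_num
  linarith

/-- Lower bound of the Lempert function with poles `(0, 0)`, `(ρ, 0)`, `(0, ε)` when `|ρ|` is much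
smaller than `|ε|`. -/
theorem le_lempertFunction_of_three_poles {z : ℂ × ℂ} {ρ ε : ℂ} {s X : ℝ} (hs : 0 < s)
    (hX : 0 < X) (hX1 : X ≤ 1) (hsX : 48 * s ≤ X ^ 2) (hz2 : ‖z.2‖ = s ^ 2)
    (hz1 : s ^ 3 / 2 ≤ ‖z.1‖) (hε : ε ≠ 0) (hρ0 : ρ ≠ 0)
    (hεs : 1024 * ‖ε‖ ≤ s ^ 2 * X ^ 3) (hρ : 64 * ‖ρ‖ ≤ s ^ 4 * X * ‖ε‖) :
    ((Real.log (s ^ 4 / X) : ℝ) : EReal) ≤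
      lempertFunction bidisk ![(0, 0), (ρ, 0), (0, ε)] z := by
  refine le_sInf ?_
  rintro _ ⟨φ, ζ, hφd, hφm, hφ0, hζ, rfl⟩
  have hb : ∀ x ∈ Metric.ball (0 : ℂ) 1, ‖(φ x).1‖ ≤ 1 ∧ ‖(φ x).2‖ ≤ 1 := fun x hx => by
    obtain ⟨h1, h2⟩ := hφm hx
    exact ⟨(mem_ball_zero_iff.mp h1).le, (mem_ball_zero_iff.mp h2).le⟩
  have h0 := (hζ 0).2
  have h1 := (hζ 1).2
  have h2 := (hζ 2).2
  simp only [Matrix.cons_val] at h0 h1 h2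
  have key := pow_four_le_mul_of_three_poles (f := fun x => (φ x).1) (g := fun x => (φ x).2)
    hφd.fst (fun x hx => (hb x hx).1) hφd.snd (fun x hx => (hb x hx).2)
    (mem_ball_zero_iff.mp (hζ 0).1) (mem_ball_zero_iff.mp (hζ 1).1)
    (mem_ball_zero_iff.mp (hζ 2).1) (by rw [h0]) (ρ := ρ) (by rw [h1]) (by rw [h2])
    (by rw [h0]) (by rw [h1]) (ε := ε) (by rw [h2]) hs hX hX1 hsX
    (by rw [hφ0, hz2]) (by rwa [hφ0]) hε hρ0 hεs hρ
  rw [Fin.sum_univ_three, ← ENNReal.log_mul_add, ← ENNReal.log_mul_add,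
    ← ENNReal.log_ofReal_of_pos (by positivity)]
  apply ENNReal.log_le_log
  rw [← enorm_mul, ← enorm_mul, ← ofReal_norm, norm_mul, norm_mul]
  exact ENNReal.ofReal_le_ofReal ((div_le_iff₀ hX).mpr key)

theorem exists_forall_norm_le_of_tendsto_div {ρ : ℂ → ℂ}
    (hρ : Tendsto (fun ε : ℂ => ρ ε / ε) (𝓝[≠] 0) (𝓝 0)) {m : ℝ} (hm : 0 < m) :
    ∃ r : ℝ, 0 < r ∧ ∀ ε : ℂ, ε ≠ 0 → ‖ε‖ < r → ‖ρ ε‖ ≤ m * ‖ε‖ := by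
  obtain ⟨r, hr, h⟩ := Metric.tendsto_nhdsWithin_nhds.mp hρ m hm
  refine ⟨r, hr, fun ε hε hεr => ?_⟩
  have := h hε (by simpa using hεr)
  rw [dist_zero_right, norm_div, div_lt_iff₀ (norm_pos_iff.mpr hε)] at this
  exact this.le

theorem proposition2 (ρ : ℂ → ℂ) (hρ : Tendsto (fun ε : ℂ => ρ ε / ε) (𝓝[≠] 0) (𝓝 0)) :
    ∃ C₁ : ℝ, 0 < C₁ ∧
      ∀ δ : ℝ, 0 < δ → δ < 1 / 4 →
        ∃ r₀ : ℝ, 0 < r₀ ∧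
          ∀ z : ℂ × ℂ, z ∈ bidisk →
            1 / 2 * ‖z.2‖ ^ (3 / 2 : ℝ) ≤ ‖z.1‖ → ‖z.1‖ ≤ ‖z.2‖ ^ (3 / 2 : ℝ) → ‖z‖ < r₀ →
            ∃ ε₀ : ℝ, 0 < ε₀ ∧
              ∀ ε : ℂ, ε ≠ 0 → ρ ε ≠ 0 → ‖ε‖ < ε₀ →
                pluricomplexGreen bidisk (threePoles ρ ε) z
                    ≤ 2 * ENNReal.log ‖z.2‖ₑ + (C₁ : EReal) ∧
                ((2 - δ : ℝ) : EReal) * ENNReal.log ‖z.2‖ₑ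
                    ≤ lempertFunction bidisk (threePoles ρ ε) z := by
  refine ⟨Real.log 256, Real.log_pos (by norm_num), fun δ hδ0 hδ1 => ?_⟩
  have hα : 0 < 1 / 2 - 2 * δ := by linarith
  -- 3/16 keeps |t| ≤ 1/2 on the cubic; the other bound gives 48s ≤ X² for s = |z₂|^{1/2}, X =
  -- |z₂|^δ, which needs δ < 1/4.
  refine ⟨min (3 / 16) ((1 / 48) ^ (1 / (1 / 2 - 2 * δ))), by positivity,
    fun z _ hz1 hz1' hzr => ?_⟩
  have hzr2 : ‖z.2‖ < min (3 / 16) ((1 / 48) ^ (1 / (1 / 2 - 2 * δ))) :=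
    (norm_snd_le z).trans_lt hzr
  rcases eq_or_ne z.2 0 with hz0 | hz0
  -- Here z = 0 is itself a pole, and both bounds read -∞.
  · have hz : z = 0 := by
      refine Prod.ext ?_ hz0
      rw [hz0, norm_zero, Real.zero_rpow (by norm_num)] at hz1'
      simpa using hz1'
    refine ⟨1, one_pos, fun ε _ _ _ => ⟨sSup_le ?_, ?_⟩⟩
    · rintro _ ⟨u, -, -, hua, rfl⟩
      obtain ⟨C, hC⟩ := hua 0
      have := hC z (by simp [hz, bidisk])
      have h2 : (2 : EReal) * ⊥ = ⊥ := EReal.coe_mul_bot_of_pos (x := 2) two_pos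
      rw [hz0, enorm_zero, ENNReal.log_zero, h2, EReal.bot_add]
      rwa [hz, show threePoles ρ ε 0 = 0 from rfl, sub_zero, enorm_zero, ENNReal.log_zero,
        EReal.bot_add, ← hz] at this
    · rw [hz0, enorm_zero, ENNReal.log_zero, EReal.coe_mul_bot_of_pos (by linarith)]
      exact bot_le
  have hq : 0 < ‖z.2‖ := norm_pos_iff.mpr hz0
  have hq1 : ‖z.2‖ ≤ 3 / 16 := (hzr2.trans_le (min_le_left _ _)).le
  have hq2 : 48 * ‖z.2‖ ^ (1 / 2 - 2 * δ) ≤ 1 := by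
    have h1 := Real.rpow_le_rpow hq.le (hzr2.trans_le (min_le_right _ _)).le hα.le
    rw [← Real.rpow_mul (by norm_num), one_div_mul_cancel hα.ne', Real.rpow_one] at h1
    linarith
  set s : ℝ := ‖z.2‖ ^ (1 / 2 : ℝ) with hs
  set X : ℝ := ‖z.2‖ ^ δ with hX
  have hs0 : 0 < s := by positivity
  have hX0 : 0 < X := by positivity
  have hX1 : X ≤ 1 := Real.rpow_le_one hq.le (by linarith) hδ0.le
  have hs2 : s ^ 2 = ‖z.2‖ := by
    rw [hs, ← Real.rpow_natCast, ← Real.rpow_mul hq.le]; norm_num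
  have hs3 : s ^ 3 = ‖z.2‖ ^ (3 / 2 : ℝ) := by
    rw [hs, ← Real.rpow_natCast, ← Real.rpow_mul hq.le]; norm_num
  have hsX : 48 * s ≤ X ^ 2 := by
    have h1 : ‖z.2‖ ^ (1 / 2 - 2 * δ) * X ^ 2 = s := by
      rw [hX, hs, ← Real.rpow_natCast, ← Real.rpow_mul hq.le, ← Real.rpow_add hq]
      congr 1
      push_cast
      ring
    rw [← h1]
    nlinarith [sq_nonneg X]
  have hlog : Real.log (s ^ 4 / X) = (2 - δ) * Real.log ‖z.2‖ := by
    rw [Real.log_div (by positivity) (by positivity), show s ^ 4 = ‖z.2‖ ^ 2 by rw [← hs2]; ring,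
      hX, Real.log_rpow hq, Real.log_pow]
    push_cast
    ring
  rw [← hs3] at hz1 hz1'
  have hz1n : 0 < ‖z.1‖ := lt_of_lt_of_le (by positivity) hz1
  obtain ⟨r₁, hr₁, h₁⟩ := exists_forall_norm_le_of_tendsto_div hρ
    (show 0 < s ^ 4 * X / 64 by positivity)
  obtain ⟨r₂, hr₂, h₂⟩ := exists_forall_norm_le_of_tendsto_div hρ
    (show 0 < ‖z.1‖ / (8 * ‖z.2‖) by positivity)
  refine ⟨min (min r₁ r₂) (min (‖z.2‖ / 8) (s ^ 2 * X ^ 3 / 1024)), by positivity,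
    fun ε hε hρε hεr => ?_⟩
  simp only [lt_min_iff] at hεr
  obtain ⟨⟨e1, e2⟩, e3, e4⟩ := hεr
  rw [log_enorm_eq_coe_log hz0]
  constructor
  · have := pluricomplexGreen_le_of_three_poles hz0 (norm_pos_iff.mp hz1n) (ρ := ρ ε) (ε := ε)
      (by
        rw [← hs2]
        calc ‖z.1‖ ^ 2 ≤ (s ^ 3) ^ 2 := by gcongr
          _ = _ := by ring)
      hq1 hε hρε (by linarith) (by
        have := h₂ ε hε e2
        rwa [div_mul_eq_mul_div, le_div_iff₀ (by positivity), mul_comm] at this)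
    rwa [EReal.coe_add, EReal.coe_mul] at this
  · have := le_lempertFunction_of_three_poles hs0 hX0 hX1 hsX hs2.symm (by linarith) hε hρε
      (by linarith) (by linarith [h₁ ε hε e1])
    rwa [hlog, EReal.coe_mul] at this
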